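/- **Conventions.** A *unital locally $C^*$-algebra* is a unital complex $*$-algebra $\mathscr A$ which is complete and Hausdorff in the topology generated by the set $\Delta=S(\mathscr A)$ of all its continuous $C^*$-seminorms; $\Delta$, ordered pointwise, is upward directed. A *Hilbert $\mathscr A$-module* is a right $\mathscr A$-module $\mathcal M$ with an $\mathscr A$-valued inner product, $\mathbb C$- and $\mathscr A$-linear in the second variable, with $\langle y,x\rangle=\langle x,y\rangle^*$, $\langle x,x\rangle\ge 0$, and $\langle x,x\rangle=0$ only for $x=0$, which is complete in the topology of the seminorms $\|x\|_p=p(\langle x,x\rangle)^{1/2}$, $p\in\Delta$. A *locally Hilbert space* over $\Delta$ is a union $\mathcal H=\bigcup_{\alpha\in\Delta}\mathcal H_\alpha$ of Hilbert spaces with $\mathcal H_\alpha$ a closed subspace of $\mathcal H_\beta$ for $\alpha\le\beta$, with the finest locally convex topology that makes all inclusions $\mathcal H_\alpha\to\mathcal H$ continuous; $[Y]$ is the closed linear span of $Y$ in this topology. For locally Hilbert spaces $\mathcal H,\mathcal K$ over $\Delta$, $\mathscr L(\mathcal H,\mathcal K)$ is the set of linear maps $T:\mathcal H\to\mathcal K$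 which restrict to bounded operators $T_\alpha:\mathcal H_\alpha\to\mathcal K_\alpha$ for all $\alpha$ and commute with the orthogonal projections onto $\mathcal H_\alpha$ and $\mathcal K_\alpha$, with the topology of the seminorms $T\mapsto\|T_\alpha\|$; the adjoint $T^*\in\mathscr L(\mathcal K,\mathcal H)$ is given by $T^*|_{\mathcal K_\alpha}=(T_\alpha)^*$. Put $\mathscr L(\mathcal H)=\mathscr L(\mathcal H,\mathcal H)$, a unital $*$-algebra. A linear map between such algebras is *completely positive* if, for every $k$, its entrywise amplification to $k\times k$ matrices maps every $a^*a$ to a positive element (one of the form $c^*c$). A matrix $(\varphi_{ij})_{i,j=1}^n$ of linear maps $\mathscr A\to\mathscr L(\mathcal H)$ is a *continuous completely $n$-positive map* if $[\varphi]:\mathbb M_n(\mathscr A)\to\mathbb M_n(\mathscr L(\mathcal H))$, $(a_{ij})\mapsto(\varphi_{ij}(a_{ij}))$, is continuous and completely positive. A matrix $[\Phi]=(\Phi_{ij})_{i,j=1}^n$ of continuous linear maps $\Phi_{ij}:\mathcal M\to\mathscr L(\mathcal H,\mathcal K)$ is *$[\varphi]$-completely positive* if $[\varphi]$ is a continuous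 completely $n$-positive map and $\sum_{r=1}^n\Phi_{ri}(x)^*\Phi_{rj}(y)=\varphi_{ij}(\langle x,y\rangle)$ for all $x,y\in\mathcal M$ and all $i,j$. **Theorem.** Let $\mathscr A$ be a unital locally $C^*$-algebra, $\mathcal M$ a Hilbert $\mathscr A$-module, $\mathcal H$ and $\mathcal K$ locally Hilbert spaces over $\Delta=S(\mathscr A)$, $[\varphi]=(\varphi_{ij})_{i,j=1}^n$ a continuous completely $n$-positive map from $\mathscr A$ to $\mathscr L(\mathcal H)$, and $[\Phi]=(\Phi_{ij})_{i,j=1}^n$ a $[\varphi]$-completely positive matrix of continuous linear maps $\Phi_{ij}:\mathcal M\to\mathscr L(\mathcal H,\mathcal K)$. Then there are locally Hilbert spaces $\mathcal H^\Phi,\mathcal K^\Phi$ over $\Delta$, a continuous unital $*$-homomorphism $\pi^\varphi:\mathscr A\to\mathscr L(\mathcal H^\Phi)$, a continuous linear map $\pi^\Phi:\mathcal M\to\mathscr L(\mathcal H^\Phi,\mathcal K^\Phi)$ with $\pi^\Phi(x)^*\pi^\Phi(y)=\pi^\varphi(\langle x,y\rangle)$ for all $x,y\in\mathcal M$, and continuous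 operators $S_i\in\mathscr L(\mathcal H,\mathcal H^\Phi)$, $W_i\in\mathscr L(\mathcal K,\mathcal K^\Phi)$ ($i=1,\dots,n$) such that 1. $\varphi_{ij}(a)=S_i^*\,\pi^\varphi(a)\,S_j$ for all $a\in\mathscr A$ and all $i,j$; 2. $\Phi_{ij}(x)=W_i^*\,\pi^\Phi(x)\,S_j$ for all $x\in\mathcal M$ and all $i,j$; 3. $\mathcal H^\Phi=[\{\pi^\varphi(a)S_i\xi:\ a\in\mathscr A,\ \xi\in\mathcal H,\ 1\le i\le n\}]$; 4. $\mathcal K^\Phi=[\{\pi^\Phi(x)S_i\xi:\ x\in\mathcal M,\ \xi\in\mathcal H,\ 1\le i\le n\}]$. -/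

import Mathlib

universe u v w w₁ w₂

noncomputable section

open scoped InnerProductSpace Topology

/-! ### Locally C*-algebras -/

/-- A continuous C*-seminorm on a topological `*`-algebra over `ℂ`. The type
`CStarSeminorm A` is the set `S(A)` of all of them. -/
structure CStarSeminorm (A : Type u) [Ring A] [StarRing A] [Algebra ℂ A]
    [TopologicalSpace A] where
  toSeminorm : Seminorm ℂ A
  continuous_toSeminorm : Continuous toSeminorm
  mul_le : ∀ a b : A, toSeminorm (a * b) ≤ toSeminorm a * toSeminorm b
  star_mul_self : ∀ a : A, toSeminorm (star a * a) = toSeminorm a ^ 2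

namespace CStarSeminorm

variable {A : Type u} [Ring A] [StarRing A] [Algebra ℂ A] [TopologicalSpace A]

instance : CoeFun (CStarSeminorm A) (fun _ => A → ℝ) := ⟨fun p => p.toSeminorm⟩

/-- Pointwise order: `p ≤ q` iff `p a ≤ q a` for all `a`. -/
instance : Preorder (CStarSeminorm A) := Preorder.lift toSeminorm

/-- The maximum of two continuous C*-seminorms is one; hence `S(A)` is upward directed. -/
instance : IsDirectedOrder (CStarSeminorm A) where
  directed p q := by
    have happ : ∀ a : A, (p.toSeminorm ⊔ q.toSeminorm) a = max (p a) (q a) := fun a => rfl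
    refine ⟨⟨p.toSeminorm ⊔ q.toSeminorm, ?_, ?_, ?_⟩, ?_, ?_⟩
    · exact p.continuous_toSeminorm.max q.continuous_toSeminorm
    · intro a b
      simp only [happ]
      refine max_le ((p.mul_le a b).trans ?_) ((q.mul_le a b).trans ?_)
      · exact mul_le_mul (le_max_left _ _) (le_max_left _ _) (apply_nonneg _ _)
          ((apply_nonneg p.toSeminorm a).trans (le_max_left _ _))
      · exact mul_le_mul (le_max_right _ _) (le_max_right _ _) (apply_nonneg _ _)
          ((apply_nonneg p.toSeminorm a).trans (le_max_left _ _))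
    · intro a
      simp only [happ, p.star_mul_self, q.star_mul_self]
      rcases le_total (p a) (q a) with h | h
      · rw [max_eq_right h, max_eq_right (pow_le_pow_left₀ (apply_nonneg _ _) h 2)]
      · rw [max_eq_left h, max_eq_left (pow_le_pow_left₀ (apply_nonneg _ _) h 2)]
    · exact (le_sup_left : p.toSeminorm ≤ p.toSeminorm ⊔ q.toSeminorm)
    · exact (le_sup_right : q.toSeminorm ≤ p.toSeminorm ⊔ q.toSeminorm)

end CStarSeminorm

/-- A unital complex `*`-algebra is a (unital) locally C*-algebra if it is complete, Hausdorff, and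
its topology is the one generated by its continuous C*-seminorms. As the maximum of two continuous
C*-seminorms is again one, the balls of the single seminorms form a basis at `0`. -/
class LocallyCStarAlgebra (A : Type u) [Ring A] [StarRing A] [Algebra ℂ A] [StarModule ℂ A]
    [UniformSpace A] [IsUniformAddGroup A] : Prop where
  complete : CompleteSpace A
  hausdorff : T2Space A
  hasBasis_nhds_zero : (𝓝 (0 : A)).HasBasis
    (fun b : CStarSeminorm A × ℝ => 0 < b.2) (fun b => {a : A | b.1 a < b.2})

/-- Positive elements of a locally C*-algebra: those of the form `c* c`. -/
def IsPositiveElement {B : Type*} [Mul B] [Star B] (b : B) : Prop := ∃ c : B, b = star c * c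

/-! ### Hilbert modules over locally C*-algebras -/

/-- A Hilbert `A`-module: a right `A`-module (a module over the opposite ring) with an `A`-valued
inner product, linear in the second variable, which is complete in the topology generated by the
seminorms `‖x‖_p = p(⟨x,x⟩)^(1/2)`, `p ∈ S(A)`. -/
class HilbertModule (A : Type u) (M : Type v) [Ring A] [StarRing A] [Algebra ℂ A] [StarModule ℂ A]
    [UniformSpace A] [IsUniformAddGroup A] [AddCommGroup M] [Module ℂ M] [Module Aᵐᵒᵖ M]
    [UniformSpace M] [IsUniformAddGroup M] extends Inner A M where
  inner_add_right : ∀ x y z : M, inner x (y + z) = inner x y + inner x z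
  inner_smul_right : ∀ (x y : M) (c : ℂ), inner x (c • y) = c • inner x y
  inner_op_smul_right : ∀ (x y : M) (a : A), inner x (MulOpposite.op a • y) = inner x y * a
  star_inner : ∀ x y : M, star (inner x y) = inner y x
  inner_self_pos : ∀ x : M, IsPositiveElement (inner x x)
  eq_zero_of_inner_self : ∀ x : M, inner x x = 0 → x = 0
  complete : CompleteSpace M
  hasBasis_nhds_zero : (𝓝 (0 : M)).HasBasis
    (fun b : CStarSeminorm A × ℝ => 0 < b.2) (fun b => {x : M | √(b.1 (inner x x)) < b.2})

/-! ### Locally Hilbert spaces -/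

/-- A locally Hilbert space: the union `H = ⋃ H_α` of an increasing family of Hilbert spaces, `H_α`
being a closed subspace of `H_β` for `α ≤ β`. The compatible inner products of the `H_α` amount to
one inner product on the union. The norm of `carrier` only records it; the topology of the locally
Hilbert space is `LocallyHilbertSpace.topology` below. -/
structure LocallyHilbertSpace (ι : Type u) [Preorder ι] [IsDirectedOrder ι] where
  carrier : Type w
  [normed : NormedAddCommGroup carrier]
  [innerProduct : InnerProductSpace ℂ carrier]
  level : ι → Submodule ℂ carrier
  level_mono : Monotone level
  [level_complete : ∀ α, CompleteSpace (level α)]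
  exists_mem_level : ∀ x : carrier, ∃ α, x ∈ level α

namespace LocallyHilbertSpace

variable {ι : Type u} [Preorder ι] [IsDirectedOrder ι]

instance : CoeSort (LocallyHilbertSpace.{u, w} ι) (Type w) := ⟨carrier⟩

attribute [instance] normed innerProduct level_complete

/-- The norm topology of the Hilbert space `H_α`. -/
@[reducible] def levelTopology (H : LocallyHilbertSpace.{u, w} ι) (α : ι) :
    TopologicalSpace (H.level α) := inferInstance

/-- The inductive limit topology: the finest locally convex vector space topology for which all the
inclusions `H_α → H` are continuous. -/
@[reducible] def topology (H : LocallyHilbertSpace.{u, w} ι) : TopologicalSpace H :=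
  sInf {τ : TopologicalSpace H | @IsTopologicalAddGroup H τ _ ∧ @ContinuousSMul ℂ H _ _ τ ∧
    @LocallyConvexSpace ℝ H _ _ _ _ τ ∧
    ∀ α, @Continuous (H.level α) H (H.levelTopology α) τ Subtype.val}

/-- `[Y]`: the closed subspace generated by `Y`, for the inductive limit topology. -/
def closedSpan (H : LocallyHilbertSpace.{u, w} ι) (Y : Set H) : Set H :=
  @closure H H.topology (Submodule.span ℂ Y : Set H)

variable {H : LocallyHilbertSpace.{u, w} ι} {K : LocallyHilbertSpace.{u, w₁} ι}
  {L : LocallyHilbertSpace.{u, w₂} ι}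

/-- The linear maps `T : H → K` that are limits of bounded operators `T_α : H_α → K_α` and satisfy
`R_α T = T P_α`, where `P_α` and `R_α` are the orthogonal projections onto `H_α` and `K_α`. -/
def opSubmodule (H : LocallyHilbertSpace.{u, w} ι) (K : LocallyHilbertSpace.{u, w₁} ι) :
    Submodule ℂ (H →ₗ[ℂ] K) where
  carrier := {T | (∀ α, ∀ x ∈ H.level α, T x ∈ K.level α) ∧
    (∀ α, ∃ C : ℝ, ∀ x ∈ H.level α, ‖T x‖ ≤ C * ‖x‖) ∧
    ∀ (α) (x : H), (K.level α).starProjection (T x) = T ((H.level α).starProjection x)}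
  add_mem' := by
    rintro T S ⟨h1, h2, h3⟩ ⟨k1, k2, k3⟩
    refine ⟨fun α x hx => (K.level α).add_mem (h1 α x hx) (k1 α x hx), fun α => ?_, fun α x => ?_⟩
    · obtain ⟨C, hC⟩ := h2 α
      obtain ⟨D, hD⟩ := k2 α
      refine ⟨C + D, fun x hx => ?_⟩
      rw [LinearMap.add_apply, add_mul]
      exact (norm_add_le _ _).trans (add_le_add (hC x hx) (hD x hx))
    · simp only [LinearMap.add_apply, map_add, h3, k3]
  zero_mem' := by
    refine ⟨fun α x _ => (K.level α).zero_mem, fun α => ⟨0, fun x _ => by simp⟩, fun α x => by simp⟩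
  smul_mem' := by
    rintro c T ⟨h1, h2, h3⟩
    refine ⟨fun α x hx => (K.level α).smul_mem c (h1 α x hx), fun α => ?_, fun α x => ?_⟩
    · obtain ⟨C, hC⟩ := h2 α
      refine ⟨‖c‖ * C, fun x hx => ?_⟩
      rw [LinearMap.smul_apply, norm_smul, mul_assoc]
      exact mul_le_mul_of_nonneg_left (hC x hx) (norm_nonneg c)
    · simp only [LinearMap.smul_apply, map_smul, h3]

/-- The space `L(H, K)`. -/
def Op (H : LocallyHilbertSpace.{u, w} ι) (K : LocallyHilbertSpace.{u, w₁} ι) : Type (max w w₁) :=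
  opSubmodule H K

namespace Op

instance : AddCommGroup (Op H K) := inferInstanceAs (AddCommGroup (opSubmodule H K))

instance : Module ℂ (Op H K) := inferInstanceAs (Module ℂ (opSubmodule H K))

/-- The underlying linear map. -/
def toLin (T : Op H K) : H →ₗ[ℂ] K := T.1

instance : CoeFun (Op H K) (fun _ => H → K) := ⟨fun T => T.toLin⟩

theorem ext {T S : Op H K} (h : ∀ x, T x = S x) : T = S := Subtype.ext (LinearMap.ext h)

theorem map_mem (T : Op H K) {α : ι} {x : H} (hx : x ∈ H.level α) : T x ∈ K.level α :=
  T.2.1 α x hx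

theorem bound (T : Op H K) (α : ι) : ∃ C : ℝ, ∀ x ∈ H.level α, ‖T x‖ ≤ C * ‖x‖ := T.2.2.1 α

theorem proj_apply (T : Op H K) (α : ι) (x : H) :
    (K.level α).starProjection (T x) = T ((H.level α).starProjection x) := T.2.2.2 α x

/-- The component `T_α : H_α → K_α`. -/
def restrict (T : Op H K) (α : ι) : H.level α →L[ℂ] K.level α :=
  LinearMap.mkContinuousOfExistsBound (T.toLin.restrict fun _ hx => T.map_mem hx)
    (by
      obtain ⟨C, hC⟩ := T.bound α
      exact ⟨C, fun x => hC x x.2⟩)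

theorem coe_restrict (T : Op H K) (α : ι) (x : H.level α) : (T.restrict α x : K) = T x := rfl

/-- The topology of `L(H, K)`, generated by the seminorms `‖T‖_α = ‖T_α‖ = ‖T_α* T_α‖^(1/2)`: the
coarsest topology for which all the maps `T ↦ T_α` are continuous for the operator norms. -/
instance : TopologicalSpace (Op H K) :=
  ⨅ α, TopologicalSpace.induced (fun T : Op H K => T.restrict α) inferInstance

/-- Composition of operators. -/
def comp (T : Op K L) (S : Op H K) : Op H L :=
  ⟨T.toLin ∘ₗ S.toLin, fun _ _ hx => T.map_mem (S.map_mem hx), fun α => by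
    obtain ⟨C, hC⟩ := T.bound α
    obtain ⟨D, hD⟩ := S.bound α
    refine ⟨|C| * D, fun x hx => ?_⟩
    calc ‖T (S x)‖ ≤ C * ‖S x‖ := hC _ (S.map_mem hx)
      _ ≤ |C| * ‖S x‖ := mul_le_mul_of_nonneg_right (le_abs_self C) (norm_nonneg _)
      _ ≤ |C| * (D * ‖x‖) := mul_le_mul_of_nonneg_left (hD x hx) (abs_nonneg C)
      _ = |C| * D * ‖x‖ := (mul_assoc _ _ _).symm,
    fun α x => by
      change (L.level α).starProjection (T (S x)) = T (S ((H.level α).starProjection x))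
      rw [T.proj_apply, S.proj_apply]⟩

theorem exists_adjoint (T : Op H K) {α : ι} {y : K} (hy : y ∈ K.level α) :
    ∀ x : H, ⟪((T.restrict α).adjoint ⟨y, hy⟩ : H), x⟫_ℂ = ⟪y, T x⟫_ℂ := by
  intro x
  set z : H.level α := (T.restrict α).adjoint ⟨y, hy⟩ with hz
  have h1 : ⟪(z : H), x⟫_ℂ = ⟪(z : H), (H.level α).starProjection x⟫_ℂ := by
    rw [← Submodule.inner_starProjection_left_eq_right,
      Submodule.starProjection_eq_self_iff.mpr z.2]
  have h2 : ⟪y, T x⟫_ℂ = ⟪y, (K.level α).starProjection (T x)⟫_ℂ := by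
    rw [← Submodule.inner_starProjection_left_eq_right,
      Submodule.starProjection_eq_self_iff.mpr hy]
  rw [h1, h2, T.proj_apply]
  have h3 := (T.restrict α).adjoint_inner_left ((H.level α).orthogonalProjectionOnto x) ⟨y, hy⟩
  exact h3

/-- The function underlying the adjoint: `T* y = (T_α)* y` for `y ∈ K_α`. -/
def adjointFun (T : Op H K) (y : K) : H :=
  ((T.restrict (K.exists_mem_level y).choose).adjoint ⟨y, (K.exists_mem_level y).choose_spec⟩ :
    H.level _)

theorem adjointFun_inner (T : Op H K) (y : K) (x : H) : ⟪T.adjointFun y, x⟫_ℂ = ⟪y, T x⟫_ℂ :=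
  T.exists_adjoint _ x

theorem adjointFun_eq (T : Op H K) {α : ι} {y : K} (hy : y ∈ K.level α) :
    T.adjointFun y = ((T.restrict α).adjoint ⟨y, hy⟩ : H) :=
  ext_inner_right ℂ fun x => by rw [adjointFun_inner, exists_adjoint]

/-- The adjoint `T* ∈ L(K, H)` of `T ∈ L(H, K)`, with `T*|K_α = (T_α)*`. -/
def adjoint (T : Op H K) : Op K H :=
  ⟨{ toFun := T.adjointFun
     map_add' := fun y z => ext_inner_right ℂ fun x => by
       simp only [inner_add_left, adjointFun_inner]
     map_smul' := fun c y => ext_inner_right ℂ fun x => by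
       simp only [RingHom.id_apply, inner_smul_left, adjointFun_inner] },
    fun α y hy => by
      change T.adjointFun y ∈ _
      rw [T.adjointFun_eq hy]
      exact Subtype.property _,
    fun α => ⟨‖(T.restrict α).adjoint‖, fun y hy => by
      change ‖T.adjointFun y‖ ≤ _
      rw [T.adjointFun_eq hy]
      exact (T.restrict α).adjoint.le_opNorm ⟨y, hy⟩⟩,
    fun α y => ext_inner_right ℂ fun x => by
      change ⟪(H.level α).starProjection (T.adjointFun y), x⟫_ℂ =
        ⟪T.adjointFun ((K.level α).starProjection y), x⟫_ℂ
      rw [Submodule.inner_starProjection_left_eq_right, adjointFun_inner, adjointFun_inner,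
        Submodule.inner_starProjection_left_eq_right, T.proj_apply]⟩

theorem adjoint_inner_left (T : Op H K) (y : K) (x : H) : ⟪T.adjoint y, x⟫_ℂ = ⟪y, T x⟫_ℂ :=
  T.adjointFun_inner y x

theorem adjoint_restrict (T : Op H K) (α : ι) :
    T.adjoint.restrict α = (T.restrict α).adjoint :=
  ContinuousLinearMap.ext fun y => Subtype.ext (T.adjointFun_eq y.2)

/-- The identity operator. -/
def idOp (H : LocallyHilbertSpace.{u, w} ι) : Op H H :=
  ⟨LinearMap.id, fun _ _ hx => hx, fun _ => ⟨1, fun x _ => by simp⟩, fun _ _ => rfl⟩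

/-- `L(H) = L(H, H)` is a unital algebra under composition. -/
instance : Ring (Op H H) where
  __ := (inferInstance : AddCommGroup (Op H H))
  mul T S := T.comp S
  one := idOp H
  mul_assoc _ _ _ := rfl
  one_mul _ := rfl
  mul_one _ := rfl
  left_distrib T S R := ext fun x => map_add T.toLin (S x) (R x)
  right_distrib _ _ _ := rfl
  zero_mul _ := rfl
  mul_zero T := ext fun _ => map_zero T.toLin

instance : Algebra ℂ (Op H H) :=
  Algebra.ofModule (fun _ _ _ => rfl) (fun c T S => ext fun x => map_smul T.toLin c (S x))

/-- The adjoint is the involution of `L(H)`. -/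
instance : StarRing (Op H H) where
  star T := T.adjoint
  star_involutive T := ext fun x => ext_inner_right ℂ fun y => by
    change ⟪T.adjoint.adjoint x, y⟫_ℂ = _
    rw [adjoint_inner_left, ← inner_conj_symm, adjoint_inner_left, inner_conj_symm]
  star_mul T S := ext fun x => ext_inner_right ℂ fun y => by
    change ⟪(T.comp S).adjoint x, y⟫_ℂ = ⟪S.adjoint (T.adjoint x), y⟫_ℂ
    rw [adjoint_inner_left, adjoint_inner_left, adjoint_inner_left]
    rfl
  star_add T S := ext fun x => ext_inner_right ℂ fun y => by
    change ⟪(T + S).adjoint x, y⟫_ℂ = ⟪T.adjoint x + S.adjoint x, y⟫_ℂ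
    rw [inner_add_left, adjoint_inner_left, adjoint_inner_left, adjoint_inner_left,
      ← inner_add_right]
    rfl

end Op

end LocallyHilbertSpace

open LocallyHilbertSpace

/-! ### Complete positivity and representations -/

/-- A linear map between `*`-algebras is completely positive if all its amplifications to `k × k`
matrices map the elements `a* a` to positive elements. -/
def IsCompletelyPositive {B C : Type*} [Ring B] [StarRing B] [Algebra ℂ B] [Ring C] [StarRing C]
    [Algebra ℂ C] (φ : B →ₗ[ℂ] C) : Prop :=
  ∀ (k : ℕ) (a : Matrix (Fin k) (Fin k) B), IsPositiveElement ((star a * a).map φ)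

/-- The map `[φ] : M_n(B) → M_n(C)`, `(b_ij) ↦ (φ_ij(b_ij))`, of a matrix of linear maps. -/
def entrywiseMap {B C : Type*} [Ring B] [Algebra ℂ B] [Ring C] [Algebra ℂ C] {n : ℕ}
    (φ : Fin n → Fin n → B →ₗ[ℂ] C) :
    Matrix (Fin n) (Fin n) B →ₗ[ℂ] Matrix (Fin n) (Fin n) C where
  toFun b := Matrix.of fun i j => φ i j (b i j)
  map_add' b c := by ext i j; simp
  map_smul' z b := by ext i j; simp

section

variable {A : Type u} [Ring A] [StarRing A] [Algebra ℂ A] [StarModule ℂ A]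
  [UniformSpace A] [IsUniformAddGroup A] {M : Type v} [AddCommGroup M] [Module ℂ M]
  [Module Aᵐᵒᵖ M] [UniformSpace M] [IsUniformAddGroup M] [HilbertModule A M]
  {ι : Type u} [Preorder ι] [IsDirectedOrder ι]
  {H : LocallyHilbertSpace.{u, w} ι} {K : LocallyHilbertSpace.{u, w₁} ι}

/-- `[Φ]` is a `[φ]`-completely positive `n × n` matrix: `[φ]` is a continuous completely
`n`-positive map from `A` to `L(H)`, the `Φ_ij` are continuous, and `[Φ](x)* [Φ](y) = [φ](⟨x,y⟩)`
entry by entry. -/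
structure IsCompletelyPositiveMatrix {n : ℕ} (φ : Fin n → Fin n → A →ₗ[ℂ] Op H H)
    (Φ : Fin n → Fin n → M →ₗ[ℂ] Op H K) : Prop where
  continuous_left : Continuous (entrywiseMap φ)
  completelyPositive_left : IsCompletelyPositive (entrywiseMap φ)
  continuous_right : ∀ i j, Continuous (Φ i j)
  sum_adjoint_comp : ∀ (x y : M) (i j : Fin n),
    ∑ r, ((Φ r i x).adjoint).comp (Φ r j y) = φ i j (inner A x y)

/-- `Π : M → L(H, K)` is a representation of the Hilbert module `M`, associated with the continuous
`*`-representation `π` of `A` on `H`. -/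
structure IsRepresentation (P : M →ₗ[ℂ] Op H K) (π : A →⋆ₐ[ℂ] Op H H) : Prop where
  continuous_module : Continuous P
  continuous_algebra : Continuous π
  adjoint_comp : ∀ x y : M, ((P x).adjoint).comp (P y) = π (inner A x y)

end

end

/-! The proof is Stinespring's construction with n cyclic families, coupled with a module map. The
kernel ⟨ξ, φ_ij(a* b) η⟩ on triples (a, i, ξ), (b, j, η) is positive semidefinite, because complete
positivity of [φ] makes every matrix (φ_{i_k i_l}(a_k* a_l)) a Gram matrix
(`IsCompletelyPositive.exists_gram`). So it is the kernel of inner products of vectors k(a, i, ξ).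
Those with ξ ∈ H_α generate level α of H^Φ, and π(c) k(a, i, ξ) = k(ca, i, ξ), S_i ξ = k(1, i, ξ).

For K^Φ no new kernel is needed. The relation between Φ and φ says exactly that the column vectors
l(x, i, ξ) = (Φ_ri(x) ξ)_r in K^n have inner products ⟨ξ, φ_ij(⟨x, y⟩) η⟩. They generate K^Φ inside
K^n; P(x) k(a, i, ξ) = l(xa, i, ξ) has adjoint l(y, i, ξ) ↦ k(⟨x, y⟩, i, ξ). The coordinate maps V_r
: K^Φ → K send l(x, j, ξ) to Φ_rj(x) ξ, so W_r = V_r* works.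

What remains is boundedness on each level. Continuity of φ gives a C*-seminorm p_α (not necessarily
α itself) and a constant C_α with ‖φ_ij(a) ξ‖ ≤ C_α p_α(a) ‖ξ‖ on H_α. Iterating Cauchy–Schwarz
along powers of c* c removes the constant and yields ‖π(c) z‖ ≤ p_α(c) ‖z‖
(`norm_linearCombination_leftMul_le`); then ‖P(x) z‖² = ⟨z, π(⟨x, x⟩) z⟩ bounds P(x).
`Generates.exists_op` turns mutually adjoint, levelwise bounded maps on generators into operators:
an adjoint that preserves levels is what forces commutation with the projections. -/

noncomputable section

open scoped InnerProductSpace Topology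

open LocallyHilbertSpace

/-! ### Locally Hilbert spaces and operators described by generators -/

namespace LocallyHilbertSpace

variable {ι : Type u} [Preorder ι] [IsDirectedOrder ι]
  {H : LocallyHilbertSpace.{u, w} ι} {K : LocallyHilbertSpace.{u, w₁} ι}

theorem isClosed_level (H : LocallyHilbertSpace.{u, w} ι) (α : ι) :
    IsClosed (H.level α : Set H) :=
  (completeSpace_coe_iff_isComplete.mp (H.level_complete α)).isClosed

/-- Elements of `L(H, K)` are continuous for the inductive limit topologies. -/
theorem Op.continuous_topology (T : Op H K) : @Continuous H K H.topology K.topology T := by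
  have hr : ∀ α, @Continuous _ _ (H.levelTopology α) (K.levelTopology α) (T.restrict α) :=
    fun α => (T.restrict α).continuous
  refine continuous_sInf_rng.mpr fun τ hτ => ?_
  obtain ⟨h1, h2, h3, h4⟩ := hτ
  rw [continuous_iff_le_induced]
  -- The pullback along T of a topology admissible for K is admissible for H, hence coarser than the
  -- inductive limit topology.
  refine sInf_le ⟨?_, ?_, ?_, fun α => ?_⟩
  · exact topologicalAddGroup_induced T.toLin
  · exact continuousSMul_induced T.toLin
  · exact LocallyConvexSpace.induced (T.toLin.restrictScalars ℝ)
  · rw [continuous_induced_rng]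
    exact @Continuous.comp _ _ _ (H.levelTopology α) (K.levelTopology α) τ _ _ (h4 α)
      (hr α)

/-- A set whose span is norm dense in every level generates the locally Hilbert space. -/
theorem closedSpan_eq_univ {Y : Set H}
    (hY : ∀ α, (H.level α : Set H) ⊆ closure (Submodule.span ℂ (Y ∩ H.level α) : Set H)) :
    H.closedSpan Y = Set.univ := by
  refine Set.eq_univ_of_forall fun x => ?_
  obtain ⟨α, hα⟩ := H.exists_mem_level x
  have hc : @Continuous (H.level α) H (H.levelTopology α) H.topology Subtype.val :=
    continuous_sInf_rng.mpr fun τ hτ => hτ.2.2.2 α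
  have hx : (⟨x, hα⟩ : H.level α) ∈ closure {z : H.level α | (z : H) ∈ Submodule.span ℂ Y} := by
    rw [closure_subtype]
    refine closure_mono ?_ (hY α hα)
    intro z hz
    exact ⟨⟨z, Submodule.span_le.mpr Set.inter_subset_right hz⟩,
      Submodule.span_mono Set.inter_subset_left hz, rfl⟩
  exact @map_mem_closure _ _ (H.levelTopology α) H.topology _ _ _ _ hc hx fun z hz => hz

variable {G G' : Type*} {s : ι → Set G} {k : G → H} {s' : ι → Set G'} {k' : G' → K}

/-- The levels of `H` are the closed linear spans of the vectors `k g`, `g ∈ s α`. -/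
structure Generates (H : LocallyHilbertSpace.{u, w} ι) (s : ι → Set G) (k : G → H) : Prop where
  exists_mem : ∀ g, ∃ α, g ∈ s α
  level_eq : ∀ α, (H.level α : Set H) = closure (Submodule.span ℂ (k '' s α) : Set H)

namespace Generates

theorem mem_level (hk : Generates H s k) {α : ι} {g : G} (hg : g ∈ s α) : k g ∈ H.level α := by
  rw [← SetLike.mem_coe, hk.level_eq]
  exact subset_closure (Submodule.subset_span ⟨g, hg, rfl⟩)

theorem inner_eq_zero (hk : Generates H s k) {α : ι} {x y : H}
    (h : ∀ g ∈ s α, ⟪k g, x⟫_ℂ = 0) (hy : y ∈ H.level α) : ⟪y, x⟫_ℂ = 0 := by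
  have h1 : Submodule.span ℂ (k '' s α) ≤ (ℂ ∙ x)ᗮ := by
    refine Submodule.span_le.mpr ?_
    rintro _ ⟨g, hg, rfl⟩
    exact Submodule.mem_orthogonal_singleton_iff_inner_left.mpr (h g hg)
  have h2 := closure_minimal (SetLike.coe_subset_coe.mpr h1) (Submodule.isClosed_orthogonal _)
  rw [← hk.level_eq] at h2
  exact Submodule.mem_orthogonal_singleton_iff_inner_left.mp (h2 hy)

theorem eq_of_inner (hk : Generates H s k) {x y : H} (h : ∀ g, ⟪k g, x⟫_ℂ = ⟪k g, y⟫_ℂ) :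
    x = y := by
  obtain ⟨α, hα⟩ := H.exists_mem_level (x - y)
  refine sub_eq_zero.mp (inner_self_eq_zero (𝕜 := ℂ).mp (hk.inner_eq_zero (fun g _ => ?_) hα))
  rw [inner_sub_right, h, sub_self]

/-- Operators are bounded only level by level, so density enters through the adjoints: their values
are vectors of H, which are determined by pairing with the generators. -/
theorem op_ext (hk : Generates H s k) {T S : Op H K} (h : ∀ g, T (k g) = S (k g)) : T = S := by
  have h1 : ∀ y, T.adjoint y = S.adjoint y := fun y => hk.eq_of_inner fun g => by
    rw [← inner_conj_symm, Op.adjoint_inner_left, h, ← Op.adjoint_inner_left, inner_conj_symm]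
  refine Op.ext fun x => ext_inner_left ℂ fun y => ?_
  rw [← Op.adjoint_inner_left, h1, Op.adjoint_inner_left]

theorem closedSpan_eq_univ (hk : Generates H s k) {Y : Set H} (hY : ∀ g, k g ∈ Y) :
    H.closedSpan Y = Set.univ := by
  refine LocallyHilbertSpace.closedSpan_eq_univ fun α => ?_
  rw [hk.level_eq]
  refine closure_mono (Submodule.span_mono ?_)
  rintro _ ⟨g, hg, rfl⟩
  exact ⟨hY g, hk.level_eq α ▸ hk.mem_level hg⟩

end Generates

/-- A linear map that respects the levels, is bounded on them, and has an adjoint on a generating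
family that also respects the levels, belongs to `L(H, K)`. -/
def Op.ofDual (hk' : Generates K s' k') (T : H →ₗ[ℂ] K) (t' : G' → H)
    (hT : ∀ α, ∀ x ∈ H.level α, T x ∈ K.level α)
    (hC : ∀ α, ∃ C : ℝ, ∀ x ∈ H.level α, ‖T x‖ ≤ C * ‖x‖)
    (ht' : ∀ α, ∀ g ∈ s' α, t' g ∈ H.level α)
    (hTt : ∀ g x, ⟪k' g, T x⟫_ℂ = ⟪t' g, x⟫_ℂ) : Op H K :=
  ⟨T, hT, hC, fun α x => by
    -- The residual T(x - P_α x) pairs with k' g as x - P_α x pairs with t' g ∈ H_α, hence to zero.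
    refine Submodule.eq_starProjection_of_mem_of_inner_eq_zero
      (hT α _ (Submodule.starProjection_apply_mem _ x)) fun y hy => ?_
    rw [← map_sub, ← inner_conj_symm, hk'.inner_eq_zero (fun g hg => ?_) hy, map_zero]
    rw [hTt]
    exact Submodule.inner_right_of_mem_orthogonal (ht' α g hg)
      (Submodule.sub_starProjection_mem_orthogonal x)⟩

/-- The bound makes the images of approximating combinations Cauchy, and completeness of K_α
supplies the limit y. The pairings with the k' g' determine y when these generate K, so extensions
obtained from different levels or sequences will agree. -/
theorem Generates.exists_extension (hk : Generates H s k) {t : G → K} {t' : G' → H} {α : ι}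
    (ht : ∀ g ∈ s α, t g ∈ K.level α) (htt : ∀ g g', ⟪k' g', t g⟫_ℂ = ⟪t' g', k g⟫_ℂ)
    {C : ℝ} (hC : ∀ v ∈ Finsupp.supported ℂ ℂ (s α),
      ‖Finsupp.linearCombination ℂ t v‖ ≤ C * ‖Finsupp.linearCombination ℂ k v‖)
    {x : H} (hx : x ∈ H.level α) :
    ∃ y ∈ K.level α, (∀ g', ⟪k' g', y⟫_ℂ = ⟪t' g', x⟫_ℂ) ∧ ‖y‖ ≤ C * ‖x‖ := by
  rw [← SetLike.mem_coe, hk.level_eq, mem_closure_iff_seq_limit] at hx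
  obtain ⟨z, hz, hlim⟩ := hx
  choose v hv hvz using fun m => Finsupp.mem_span_image_iff_linearCombination ℂ |>.mp (hz m)
  set L := Finsupp.linearCombination ℂ t with hL
  have hmem : ∀ m, L (v m) ∈ K.level α := fun m => by
    rw [hL, Finsupp.linearCombination_apply]
    exact Submodule.sum_mem _ fun g hg => Submodule.smul_mem _ _ (ht g (hv m hg))
  have hbd : ∀ m l, ‖L (v m) - L (v l)‖ ≤ |C| * ‖z m - z l‖ := fun m l => by
    rw [← map_sub, ← hvz, ← hvz, ← map_sub]
    exact (hC _ (Submodule.sub_mem _ (hv m) (hv l))).trans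
      (mul_le_mul_of_nonneg_right (le_abs_self C) (norm_nonneg _))
  have hcau : CauchySeq fun m => L (v m) := by
    have h1 := hlim.cauchySeq
    rw [Metric.cauchySeq_iff] at h1 ⊢
    intro ε hε
    obtain ⟨N, hN⟩ := h1 (ε / (|C| + 1)) (by positivity)
    refine ⟨N, fun m hm l hl => ?_⟩
    have h2 := hN m hm l hl
    rw [dist_eq_norm] at h2 ⊢
    rw [lt_div_iff₀ (by positivity)] at h2
    refine (hbd m l).trans_lt (lt_of_le_of_lt ?_ h2)
    nlinarith [norm_nonneg (z m - z l)]
  obtain ⟨y, hy, hylim⟩ := cauchySeq_tendsto_of_isComplete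
    (completeSpace_coe_iff_isComplete.mp (K.level_complete α)) hmem hcau
  refine ⟨y, hy, fun g' => ?_, ?_⟩
  · refine tendsto_nhds_unique (tendsto_const_nhds.inner hylim)
      ((tendsto_const_nhds.inner hlim).congr fun m => ?_)
    rw [← hvz, hL, Finsupp.linearCombination_apply, Finsupp.linearCombination_apply,
      Finsupp.inner_sum, Finsupp.inner_sum]
    exact Finsupp.sum_congr fun g _ => by simp only [inner_smul_right, htt]
  · refine le_of_tendsto_of_tendsto' hylim.norm (hlim.norm.const_mul C) fun m => ?_
    rw [← hvz]
    exact hC _ (hv m)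

/-- An operator is determined by mutually adjoint maps on generating families that respect the
levels and are bounded on them. -/
theorem Generates.exists_op (hk : Generates H s k) (hk' : Generates K s' k') (t : G → K)
    (t' : G' → H) (ht : ∀ α, ∀ g ∈ s α, t g ∈ K.level α)
    (ht' : ∀ α, ∀ g ∈ s' α, t' g ∈ H.level α)
    (htt : ∀ g g', ⟪k' g', t g⟫_ℂ = ⟪t' g', k g⟫_ℂ) (C : ι → ℝ)
    (hC : ∀ α, ∀ v ∈ Finsupp.supported ℂ ℂ (s α),
      ‖Finsupp.linearCombination ℂ t v‖ ≤ C α * ‖Finsupp.linearCombination ℂ k v‖) :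
    ∃ T : Op H K, (∀ g, T (k g) = t g) ∧ (∀ g', T.adjoint (k' g') = t' g') ∧
      ∀ α, ∀ x ∈ H.level α, ‖T x‖ ≤ C α * ‖x‖ := by
  have hex : ∀ x, ∃ y : K, ∀ g', ⟪k' g', y⟫_ℂ = ⟪t' g', x⟫_ℂ := fun x => by
    obtain ⟨α, hα⟩ := H.exists_mem_level x
    obtain ⟨y, -, hy, -⟩ := hk.exists_extension (ht α) htt (hC α) hα
    exact ⟨y, hy⟩
  choose f hf using hex
  have hlev : ∀ α, ∀ x ∈ H.level α, f x ∈ K.level α ∧ ‖f x‖ ≤ C α * ‖x‖ := fun α x hx => by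
    obtain ⟨y, hyl, hy, hyC⟩ := hk.exists_extension (ht α) htt (hC α) hx
    -- The value f x was chosen through an unspecified level containing x; its pairings identify it
    -- with the extension made at level α.
    obtain rfl : f x = y := hk'.eq_of_inner fun g' => by rw [hf, hy]
    exact ⟨hyl, hyC⟩
  let T : H →ₗ[ℂ] K :=
    { toFun := f
      map_add' := fun x y => hk'.eq_of_inner fun g' => by simp only [inner_add_right, hf]
      map_smul' := fun c x => hk'.eq_of_inner fun g' => by
        simp only [inner_smul_right, hf, RingHom.id_apply] }
  let T' : Op H K := Op.ofDual hk' T t' (fun α x hx => (hlev α x hx).1)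
    (fun α => ⟨C α, fun x hx => (hlev α x hx).2⟩) ht' fun g x => hf x g
  refine ⟨T', fun g => ?_, fun g' => ?_, fun α x hx => (hlev α x hx).2⟩
  · exact hk'.eq_of_inner fun g' => (hf _ _).trans (htt _ _).symm
  · refine ext_inner_right ℂ fun x => ?_
    rw [Op.adjoint_inner_left]
    exact hf _ _

/-- A monotone family of sets of vectors of an inner product space whose closed linear spans are
complete generates a locally Hilbert space inside that inner product space. -/
theorem exists_generates [Nonempty ι] {E : Type w} [NormedAddCommGroup E] [InnerProductSpace ℂ E]
    (k : G → E) (hs : Monotone s) (hmem : ∀ g, ∃ α, g ∈ s α)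
    (hc : ∀ α, IsComplete (closure (Submodule.span ℂ (k '' s α) : Set E))) :
    ∃ (H : LocallyHilbertSpace.{u, w} ι) (j : H →ₗᵢ[ℂ] E) (k' : G → H),
      (∀ g, j (k' g) = k g) ∧ Generates H s k' := by
  let L : ι → Submodule ℂ E := fun α => (Submodule.span ℂ (k '' s α)).topologicalClosure
  have hL : Monotone L := fun α β h =>
    Submodule.topologicalClosure_mono (Submodule.span_mono (Set.image_mono (hs h)))
  have hle : ∀ α, L α ≤ ⨆ α, L α := fun α => le_iSup L α
  let X : Submodule ℂ E := ⨆ α, L α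
  have hcl : ∀ α, CompleteSpace ((L α).comap X.subtype) := fun α => by
    refine completeSpace_coe_iff_isComplete.mpr ?_
    rw [
      ← isComplete_image_iff X.subtypeₗᵢ.isometry.isUniformInducing]
    have : X.subtypeₗᵢ '' ((L α).comap X.subtype) = L α := by
      ext x
      exact ⟨fun ⟨y, hy, h⟩ => h ▸ hy, fun hx => ⟨⟨x, hle α hx⟩, hx, rfl⟩⟩
    rw [this]
    exact hc α
  let H : LocallyHilbertSpace.{u, w} ι :=
    { carrier := X
      level := fun α => (L α).comap X.subtype
      level_mono := fun α β h => Submodule.comap_mono (hL h)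
      level_complete := hcl
      exists_mem_level := fun x => (Submodule.mem_iSup_of_directed L hL.directed_le).mp x.2 }
  have hkX : ∀ α, ∀ g ∈ s α, k g ∈ L α := fun α g hg =>
    subset_closure (Submodule.subset_span ⟨g, hg, rfl⟩)
  let k' : G → X := fun g => ⟨k g, by
    obtain ⟨α, hα⟩ := hmem g
    exact hle α (hkX α g hα)⟩
  refine ⟨H, X.subtypeₗᵢ, k', fun g => rfl, hmem, fun α => ?_⟩
  have himg : ((↑) : X → E) '' (Submodule.span ℂ (k' '' s α) : Set X) =
      Submodule.span ℂ (k '' s α) := by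
    have := Submodule.map_span X.subtype (k' '' s α)
    rw [← Set.image_comp] at this
    exact congrArg (fun S : Submodule ℂ E => (S : Set E)) this
  ext x
  change (x : E) ∈ closure (Submodule.span ℂ (k '' s α) : Set E) ↔
    x ∈ closure (Submodule.span ℂ (k' '' s α) : Set X)
  rw [closure_subtype, himg]

end LocallyHilbertSpace

/-! ### Positive semidefinite kernels and a growth inequality -/

open scoped ComplexConjugate in
/-- A positive semidefinite kernel is the Gram matrix of a family of vectors of a Hilbert space. -/
theorem exists_inner_eq_kernel {G : Type w} (κ : G → G → ℂ)
    (hsymm : ∀ g h, conj (κ g h) = κ h g)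
    (hpos : ∀ v : G →₀ ℂ, 0 ≤ (v.sum fun g c => v.sum fun h d => conj c * d * κ g h).re) :
    ∃ (E : Type w) (_ : NormedAddCommGroup E) (_ : InnerProductSpace ℂ E) (_ : CompleteSpace E)
      (k : G → E), ∀ g h, ⟪k g, k h⟫_ℂ = κ g h := by
  let K : Matrix G G (ℂ →L[ℂ] ℂ) := Matrix.of fun g h => κ g h • (1 : ℂ →L[ℂ] ℂ)
  have hK : K.PosSemidef := by
    have htfae := (RKHS.posSemidef_tfae (K := K)).out 0 2
    refine htfae.mpr ⟨?_, fun v => ?_⟩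
    · ext g h
      simp [K, Matrix.conjTranspose_apply, hsymm]
    · refine (hpos v).trans_eq ?_
      rw [← Complex.conj_re]
      change _ = Complex.re _
      rw [map_finsuppSum, Finsupp.sum_comm]
      congr 1
      refine Finsupp.sum_congr fun g _ => ?_
      rw [map_finsuppSum]
      refine Finsupp.sum_congr fun h _ => ?_
      simp [K]
      ring
  have : Fact K.PosSemidef := ⟨hK⟩
  refine ⟨RKHS.OfKernel K, inferInstance, inferInstance, inferInstance,
    fun g => RKHS.kerFun (RKHS.OfKernel K) g 1, fun g h => ?_⟩
  rw [← RKHS.kernel_inner, RKHS.OfKernel.kernel_ofKernel]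
  simp [K, hsymm]

theorem inner_linearCombination_congr {G G' E F : Type*} [NormedAddCommGroup E]
    [InnerProductSpace ℂ E] [NormedAddCommGroup F] [InnerProductSpace ℂ F]
    {a : G → E} {b : G' → E} {a' : G → F} {b' : G' → F} (h : ∀ g g', ⟪a g, b g'⟫_ℂ = ⟪a' g, b' g'⟫_ℂ)
    (v : G →₀ ℂ) (v' : G' →₀ ℂ) :
    ⟪Finsupp.linearCombination ℂ a v, Finsupp.linearCombination ℂ b v'⟫_ℂ =
      ⟪Finsupp.linearCombination ℂ a' v, Finsupp.linearCombination ℂ b' v'⟫_ℂ := by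
  simp only [Finsupp.linearCombination_apply, Finsupp.sum, sum_inner, inner_sum, inner_smul_left,
    inner_smul_right, h]

/-- If `x k ^ 2 ≤ N * x (k + 1)` and `x` grows at most like `q ^ 2 ^ k`, then `x 0 ≤ N * q`. -/
theorem le_mul_of_sq_le_mul_succ {x : ℕ → ℝ} {N q D : ℝ} (hN : 0 ≤ N) (hq : 0 ≤ q)
    (h1 : ∀ k, x k ^ 2 ≤ N * x (k + 1)) (h2 : ∀ k, x k ≤ D * q ^ 2 ^ k) : x 0 ≤ N * q := by
  by_contra! hlt
  rcases hN.eq_or_lt with rfl | hN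
  · have := h1 0
    nlinarith
  have hr : q < x 0 / N := by rwa [lt_div_iff₀ hN, mul_comm]
  set r := x 0 / N with hr'
  have hr0 : 0 < r := hq.trans_lt hr
  -- Since x 0 = N r with r > q, repeated squaring forces growth like r ^ 2 ^ k, which outruns D q ^
  -- 2 ^ k.
  have hx : ∀ k, N * r ^ 2 ^ k ≤ x k := by
    intro k
    induction k with
    | zero => rw [hr', pow_zero, pow_one, mul_div_cancel₀ _ hN.ne']
    | succ k ih =>
      have h3 := (pow_le_pow_left₀ (by positivity) ih 2).trans (h1 k)
      rw [pow_succ 2 k, pow_mul]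
      refine le_of_mul_le_mul_left ?_ hN
      calc N * (N * (r ^ 2 ^ k) ^ 2) = (N * r ^ 2 ^ k) ^ 2 := by ring
        _ ≤ _ := h3
  rcases hq.eq_or_lt with rfl | hq
  · have := (hx 0).trans (h2 0)
    simp at this
    nlinarith [mul_pos hN hr0]
  obtain ⟨m, hm⟩ := pow_unbounded_of_one_lt (D / N) ((one_lt_div hq).mpr hr)
  have h3 : (r / q) ^ m ≤ (r / q) ^ 2 ^ m :=
    pow_le_pow_right₀ ((one_lt_div hq).mpr hr).le Nat.lt_two_pow_self.le
  have h4 := (hx m).trans (h2 m)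
  have h5 := hm.trans_le h3
  rw [div_pow, div_lt_div_iff₀ hN (by positivity)] at h5
  linarith

/-! ### Bounds by continuous C*-seminorms -/

section

variable {A : Type u} [Ring A] [StarRing A] [Algebra ℂ A]

instance [TopologicalSpace A] : Nonempty (CStarSeminorm A) :=
  ⟨⟨0, continuous_const, by simp, by simp⟩⟩

theorem CStarSeminorm.pow_le [TopologicalSpace A] (p : CStarSeminorm A) (a : A) (m : ℕ) :
    p (a ^ (m + 1)) ≤ p a ^ (m + 1) := by
  induction m with
  | zero => simp
  | succ m ih =>
    rw [pow_succ, pow_succ (p a)]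
    exact (p.mul_le _ _).trans (mul_le_mul_of_nonneg_right ih (apply_nonneg _ _))

variable [StarModule ℂ A] [UniformSpace A] [IsUniformAddGroup A] [LocallyCStarAlgebra A]

/-- Finitely many continuous linear maps on a locally C*-algebra with values in a normed space are
bounded by a multiple of one continuous C*-seminorm. -/
theorem exists_cstarSeminorm_bound {J F : Type*} [Finite J] [NormedAddCommGroup F]
    [NormedSpace ℂ F] (f : J → A →ₗ[ℂ] F) (hf : ∀ j, Continuous (f j)) :
    ∃ (p : CStarSeminorm A) (C : ℝ), 0 ≤ C ∧ ∀ j a, ‖f j a‖ ≤ C * p a := by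
  have h1 : ∀ᶠ a in 𝓝 (0 : A), ∀ j, ‖f j a‖ < 1 := by
    refine Filter.eventually_all.mpr fun j => ?_
    have := ((hf j).norm.tendsto 0)
    rw [map_zero, norm_zero] at this
    exact this.eventually (gt_mem_nhds one_pos)
  obtain ⟨⟨p, ε⟩, hε, hp⟩ := LocallyCStarAlgebra.hasBasis_nhds_zero.mem_iff.mp h1
  simp only at hε
  refine ⟨p, 1 / ε, by positivity, fun j a => ?_⟩
  refine le_of_forall_pos_le_add fun δ hδ => ?_
  have hpa : 0 ≤ p a := apply_nonneg _ _
  -- The term ε δ keeps the denominator positive when p a = 0 and costs only an additive δ in the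
  -- final bound.
  set r : ℝ := ε / (p a + ε * δ) with hr
  have hr0 : 0 < r := by positivity
  have h2 : p ((r : ℂ) • a) < ε := by
    rw [map_smul_eq_mul, Complex.norm_real, Real.norm_of_nonneg hr0.le, hr, div_mul_eq_mul_div,
      div_lt_iff₀ (by positivity)]
    have : 0 < ε * δ := by positivity
    nlinarith
  have h3 : ‖f j ((r : ℂ) • a)‖ < 1 := hp h2 j
  rw [map_smul, norm_smul, Complex.norm_real, Real.norm_of_nonneg hr0.le, hr, div_mul_eq_mul_div,
    div_lt_one (by positivity)] at h3
  rw [← mul_le_mul_iff_right₀ hε]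
  refine h3.le.trans_eq ?_
  field_simp

end

/-! ### Adjoints and continuity in L(H, K) -/

namespace LocallyHilbertSpace.Op

variable {ι : Type u} [Preorder ι] [IsDirectedOrder ι]
  {H : LocallyHilbertSpace.{u, w} ι} {K : LocallyHilbertSpace.{u, w₁} ι}

theorem sum_apply {J : Type*} (s : Finset J) (T : J → Op H K) (x : H) :
    (∑ j ∈ s, T j : Op H K) x = ∑ j ∈ s, T j x := by
  have h1 : (∑ j ∈ s, T j : Op H K).toLin = ∑ j ∈ s, (T j).toLin :=
    map_sum (opSubmodule H K).subtype T s
  rw [h1, LinearMap.sum_apply]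

theorem inner_adjoint_right (T : Op H K) (x : H) (y : K) :
    ⟪x, T.adjoint y⟫_ℂ = ⟪T x, y⟫_ℂ := by
  rw [← inner_conj_symm, adjoint_inner_left, inner_conj_symm]

theorem adjoint_adjoint (T : Op H K) : T.adjoint.adjoint = T :=
  ext fun x => ext_inner_right ℂ fun y => by rw [adjoint_inner_left, inner_adjoint_right]

/-- The component map `T ↦ T_α`. -/
def restrictₗ (H : LocallyHilbertSpace.{u, w} ι) (K : LocallyHilbertSpace.{u, w₁} ι) (α : ι) :
    Op H K →ₗ[ℂ] H.level α →L[ℂ] K.level α where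
  toFun T := T.restrict α
  map_add' _ _ := rfl
  map_smul' _ _ := rfl

theorem continuous_restrict (α : ι) : Continuous fun T : Op H K => T.restrict α :=
  continuous_iInf_dom continuous_induced_dom

theorem norm_apply_le_restrict (T : Op H K) {α : ι} {x : H} (hx : x ∈ H.level α) :
    ‖T x‖ ≤ ‖T.restrict α‖ * ‖x‖ :=
  (T.restrict α).le_opNorm ⟨x, hx⟩

/-- A linear map into `L(H, K)` is continuous if all its components are bounded on a neighbourhood
basis of `0`. -/
theorem continuous_of_bound {B : Type*} [AddCommGroup B] [Module ℂ B] [TopologicalSpace B]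
    [IsTopologicalAddGroup B] (f : B →ₗ[ℂ] Op H K)
    (h : ∀ α, ∀ ε > 0, ∀ᶠ b in 𝓝 0, ∀ x ∈ H.level α, ‖f b x‖ ≤ ε * ‖x‖) : Continuous f := by
  refine continuous_iInf_rng.mpr fun α => continuous_induced_rng.mpr ?_
  refine continuous_of_continuousAt_zero (restrictₗ H K α ∘ₗ f) ?_
  rw [ContinuousAt, map_zero]
  refine (Metric.tendsto_nhds (α := H.level α →L[ℂ] K.level α)).mpr ?_
  intro ε hε
  filter_upwards [h α (ε / 2) (half_pos hε)] with b hb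
  refine lt_of_le_of_lt ?_ (half_lt_self hε)
  refine (dist_zero_right (E := H.level α →L[ℂ] K.level α) _).trans_le ?_
  exact ContinuousLinearMap.opNorm_le_bound _ (half_pos hε).le fun x => hb x x.2

end LocallyHilbertSpace.Op

/-! ### The Stinespring kernel of a completely n-positive map -/

/-- Left multiplication on the generators of Stinespring's construction. -/
def leftMul {A X : Type*} [Mul A] (c : A) (g : A × X) : A × X := (c * g.1, g.2)

theorem leftMul_mul {A X : Type*} [Semigroup A] (c d : A) (g : A × X) :
    leftMul (c * d) g = leftMul c (leftMul d g) := by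
  simp [leftMul, mul_assoc]

theorem one_leftMul {A X : Type*} [MulOneClass A] (g : A × X) : leftMul 1 g = g := by
  simp [leftMul]

section

variable {A : Type u} [Ring A] [StarRing A] [Algebra ℂ A] {ι : Type u} [Preorder ι]
  [IsDirectedOrder ι] {H : LocallyHilbertSpace.{u, w} ι} {n : ℕ}
  {φ : Fin n → Fin n → A →ₗ[ℂ] Op H H}

theorem IsCompletelyPositive.exists_gram_fin (hφ : IsCompletelyPositive (entrywiseMap φ)) {m : ℕ}
    (i : Fin m → Fin n) (a : Fin m → A) :
    ∃ d : Fin m × Fin n → Fin m → Op H H, ∀ k l,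
      φ (i k) (i l) (star (a k) * a l) = ∑ ν, star (d ν k) * d ν l := by
  rcases m.eq_zero_or_pos with rfl | hm
  · exact ⟨0, fun k => k.elim0⟩
  let o : Fin m := ⟨0, hm⟩
  -- Only row o is nonzero, with entries a_k ⊗ E_{i_o, i_k}, so (b* b)_{kl} = a_k* a_l ⊗ E_{i_k,
  -- i_l}. The inner row index i_o is arbitrary: it cancels in the product. Reading off the entry
  -- (i_k, i_l) of [φ] isolates the wanted component of φ.
  let b : Matrix (Fin m) (Fin m) (Matrix (Fin n) (Fin n) A) :=
    Matrix.of fun s k => if s = o then Matrix.single (i o) (i k) (a k) else 0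
  obtain ⟨c, hc⟩ := hφ m b
  refine ⟨fun ν k => c ν.1 k ν.2 (i k), fun k l => ?_⟩
  have hb : (star b * b) k l = Matrix.single (i k) (i l) (star (a k) * a l) := by
    rw [Matrix.mul_apply, Finset.sum_eq_single o]
    · simp [b, Matrix.star_apply, Matrix.star_eq_conjTranspose]
    · intro s _ hs
      simp [b, hs]
    · simp
  have h1 := congrFun (congrFun (congrFun (congrFun hc k) l) (i k)) (i l)
  rw [Matrix.map_apply, hb, Matrix.mul_apply] at h1
  simp only [entrywiseMap, LinearMap.coe_mk, AddHom.coe_mk, Matrix.of_apply,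
    Matrix.single_apply_same] at h1
  rw [h1, Matrix.sum_apply, Fintype.sum_prod_type]
  refine Finset.sum_congr rfl fun s _ => ?_
  rw [Matrix.mul_apply]
  rfl

/-- The matrix `(φ_{i_k i_l}(a_k* a_l))` is a Gram matrix. -/
theorem IsCompletelyPositive.exists_gram (hφ : IsCompletelyPositive (entrywiseMap φ)) {J : Type*}
    [Fintype J] (i : J → Fin n) (a : J → A) :
    ∃ (N : ℕ) (d : Fin N × Fin n → J → Op H H), ∀ k l,
      φ (i k) (i l) (star (a k) * a l) = ∑ ν, star (d ν k) * d ν l := by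
  let e := Fintype.equivFin J
  obtain ⟨d, hd⟩ := hφ.exists_gram_fin (i ∘ e.symm) (a ∘ e.symm)
  refine ⟨_, fun ν k => d ν (e k), fun k l => ?_⟩
  simpa using hd (e k) (e l)

/-- A Gram matrix is Hermitian; the 2 × 2 case already gives the claim. -/
theorem IsCompletelyPositive.star_apply (hφ : IsCompletelyPositive (entrywiseMap φ)) (i j : Fin n)
    (a b : A) : star (φ i j (star a * b)) = φ j i (star b * a) := by
  obtain ⟨N, d, hd⟩ := hφ.exists_gram ![i, j] ![a, b]
  have h1 := hd 0 1
  have h2 := hd 1 0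
  simp only [Matrix.cons_val_zero, Matrix.cons_val_one] at h1 h2
  rw [h1, h2, star_sum]
  simp only [star_mul, star_star]

/-- The kernel `⟨a ⊗ ξ e_i, b ⊗ η e_j⟩ = ⟨ξ, φ_ij(a* b) η⟩` of Stinespring's construction. -/
def stinespringKernel (φ : Fin n → Fin n → A →ₗ[ℂ] Op H H) (g h : A × Fin n × H) : ℂ :=
  ⟪g.2.2, φ g.2.1 h.2.1 (star g.1 * h.1) h.2.2⟫_ℂ

open scoped ComplexConjugate in
theorem IsCompletelyPositive.conj_stinespringKernel (hφ : IsCompletelyPositive (entrywiseMap φ))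
    (g h : A × Fin n × H) : conj (stinespringKernel φ g h) = stinespringKernel φ h g := by
  rw [stinespringKernel, inner_conj_symm, ← Op.inner_adjoint_right]
  exact congrArg (fun T : Op H H => ⟪h.2.2, T g.2.2⟫_ℂ) (hφ.star_apply _ _ _ _)

open scoped ComplexConjugate in
-- Factoring the matrix of φ as a Gram matrix of operators d turns the quadratic form into a sum
-- over ν of ‖∑_g v_g d_ν(g) ξ_g‖².
theorem IsCompletelyPositive.stinespringKernel_nonneg
    (hφ : IsCompletelyPositive (entrywiseMap φ)) (v : A × Fin n × H →₀ ℂ) :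
    0 ≤ (v.sum fun g c => v.sum fun h d => conj c * d * stinespringKernel φ g h).re := by
  obtain ⟨N, d, hd⟩ := hφ.exists_gram (J := v.support) (fun g => g.1.2.1) (fun g => g.1.1)
  have h1 : (v.sum fun g c => v.sum fun h d => conj c * d * stinespringKernel φ g h) =
      ∑ ν, ⟪∑ g : v.support, v g • d ν g g.1.2.2, ∑ g : v.support, v g • d ν g g.1.2.2⟫_ℂ := by
    have h2 : ∀ g h : v.support, conj (v g) * v h * stinespringKernel φ g h =
        ∑ ν, ⟪v g • d ν g g.1.2.2, v h • d ν h h.1.2.2⟫_ℂ := fun g h => by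
      rw [stinespringKernel, hd g h, Op.sum_apply, inner_sum, Finset.mul_sum]
      refine Finset.sum_congr rfl fun ν _ => ?_
      rw [inner_smul_left, inner_smul_right, ← mul_assoc, ← Op.inner_adjoint_right]
      rfl
    calc _ = ∑ g : v.support, ∑ h : v.support, conj (v g) * v h * stinespringKernel φ g h := by
          simp only [Finsupp.sum]
          rw [← Finset.sum_coe_sort]
          exact Finset.sum_congr rfl fun g _ => (Finset.sum_coe_sort _ _).symm
      _ = ∑ ν, ∑ g : v.support, ∑ h : v.support,
          ⟪v g • d ν g g.1.2.2, v h • d ν h h.1.2.2⟫_ℂ := by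
          simp only [h2]
          exact (Finset.sum_congr rfl fun g _ => Finset.sum_comm).trans Finset.sum_comm
      _ = _ := Finset.sum_congr rfl fun ν _ => by
          rw [sum_inner]
          exact Finset.sum_congr rfl fun g _ => (inner_sum _ _ _).symm
  rw [h1, Complex.re_sum]
  exact Finset.sum_nonneg fun ν _ => inner_self_nonneg (𝕜 := ℂ)

theorem stinespringKernel_leftMul (c : A) (g h : A × Fin n × H) :
    stinespringKernel φ g (leftMul c h) = stinespringKernel φ (leftMul (star c) g) h := by
  simp [stinespringKernel, leftMul, mul_assoc]

/-- The generators `a ⊗ ξ e_i` with `ξ ∈ H_α`. -/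
def stinespringSet (A : Type u) (n : ℕ) (H : LocallyHilbertSpace.{u, w} ι) (α : ι) :
    Set (A × Fin n × H) := {g | g.2.2 ∈ H.level α}

variable [TopologicalSpace A] {E : Type*} [NormedAddCommGroup E] [InnerProductSpace ℂ E]
  {k : A × Fin n × H → E}

/-- A crude estimate with a constant depending on g. Only its linearity in p c matters, as the
growth hypothesis of the iteration that follows. -/
theorem norm_leftMul_generator_le (hk : ∀ g h, ⟪k g, k h⟫_ℂ = stinespringKernel φ g h)
    {α : ι} {p : CStarSeminorm A} {C : ℝ} (hC : 0 ≤ C)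
    (hp : ∀ i j a, ∀ x ∈ H.level α, ‖φ i j a x‖ ≤ C * p a * ‖x‖)
    {g : A × Fin n × H} (hg : g ∈ stinespringSet A n H α) (c : A) :
    ‖k (leftMul c g)‖ ≤ √C * p g.1 * ‖g.2.2‖ * p c := by
  have h0 : ∀ a, 0 ≤ p a := fun a => apply_nonneg _ _
  refine le_of_sq_le_sq ?_ (mul_nonneg (mul_nonneg (mul_nonneg (Real.sqrt_nonneg _) (h0 _))
    (norm_nonneg _)) (h0 _))
  rw [← inner_self_eq_norm_sq (𝕜 := ℂ), hk]
  refine (Complex.re_le_norm _).trans ((norm_inner_le_norm _ _).trans ?_)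
  refine (mul_le_mul_of_nonneg_left (hp _ _ _ _ hg) (norm_nonneg _)).trans ?_
  rw [show p (star (leftMul c g).1 * (leftMul c g).1) = p (c * g.1) ^ 2 from p.star_mul_self _,
    mul_pow, mul_pow, mul_pow, Real.sq_sqrt hC]
  have h1 : p (c * g.1) ^ 2 ≤ (p c * p g.1) ^ 2 := pow_le_pow_left₀ (h0 _) (p.mul_le _ _) 2
  calc ‖g.2.2‖ * (C * p (c * g.1) ^ 2 * ‖g.2.2‖) = C * ‖g.2.2‖ ^ 2 * p (c * g.1) ^ 2 := by ring
    _ ≤ C * ‖g.2.2‖ ^ 2 * (p c * p g.1) ^ 2 := mul_le_mul_of_nonneg_left h1 (by positivity)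
    _ = _ := by ring

/-- Left multiplication by `c` is bounded by `p c` for the seminorm defined by the kernel. -/
theorem norm_linearCombination_leftMul_le
    (hk : ∀ g h, ⟪k g, k h⟫_ℂ = stinespringKernel φ g h)
    {α : ι} {p : CStarSeminorm A} {C : ℝ} (hC : 0 ≤ C)
    (hp : ∀ i j a, ∀ x ∈ H.level α, ‖φ i j a x‖ ≤ C * p a * ‖x‖)
    {v : A × Fin n × H →₀ ℂ} (hv : v ∈ Finsupp.supported ℂ ℂ (stinespringSet A n H α)) (c : A) :
    ‖Finsupp.linearCombination ℂ (fun g => k (leftMul c g)) v‖ ≤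
      p c * ‖Finsupp.linearCombination ℂ k v‖ := by
  set f : A → E := fun c => Finsupp.linearCombination ℂ (fun g => k (leftMul c g)) v with hf
  set N := ‖Finsupp.linearCombination ℂ k v‖ with hN
  have h0 : ∀ a, 0 ≤ p a := fun a => apply_nonneg _ _
  -- Moving c across the inner product gives ‖f c‖² = ⟨f 1, f(c* c)⟩; then Cauchy–Schwarz.
  have hsq : ∀ c, ‖f c‖ ^ 2 ≤ N * ‖f (star c * c)‖ := fun c => by
    rw [← inner_self_eq_norm_sq (𝕜 := ℂ), hf]
    simp only
    rw [inner_linearCombination_congr (a' := k) (b' := fun g => k (leftMul (star c * c) g))]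
    · exact (Complex.re_le_norm _).trans (norm_inner_le_norm _ _)
    · intro g h
      rw [hk, hk, leftMul_mul, stinespringKernel_leftMul (star c), star_star]
  obtain ⟨D, hD⟩ : ∃ D, ∀ c, ‖f c‖ ≤ D * p c := by
    refine ⟨v.sum fun g z => ‖z‖ * (√C * p g.1 * ‖g.2.2‖), fun c => ?_⟩
    rw [hf]
    simp only [Finsupp.linearCombination_apply, Finsupp.sum]
    rw [Finset.sum_mul]
    refine (norm_sum_le _ _).trans (Finset.sum_le_sum fun g hg => ?_)
    rw [norm_smul, mul_assoc]
    exact mul_le_mul_of_nonneg_left (norm_leftMul_generator_le hk hC hp (hv hg) c) (norm_nonneg _)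
  have hD0 : ∀ c, ‖f c‖ ≤ |D| * p c := fun c =>
    (hD c).trans (mul_le_mul_of_nonneg_right (le_abs_self D) (h0 c))
  set b := star c * c with hb
  have hbs : ∀ m, star (b ^ m) = b ^ m := fun m => by rw [star_pow, hb, star_mul, star_star]
  have h1 : ‖f b‖ ≤ N * p b := by
    -- As b is self-adjoint, `hsq` at b ^ 2 ^ m relates consecutive terms of ‖f(b ^ 2 ^ m)‖; the
    -- constant D disappears in the limit.
    have := le_mul_of_sq_le_mul_succ (x := fun m => ‖f (b ^ 2 ^ m)‖) (D := |D|) (norm_nonneg _) (h0 b)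
      (fun m => by
        have := hsq (b ^ 2 ^ m)
        rwa [hbs, ← pow_add, ← two_mul, ← pow_succ'] at this)
      (fun m => by
        refine (hD0 _).trans (mul_le_mul_of_nonneg_left ?_ (abs_nonneg D))
        obtain ⟨l, hl⟩ := Nat.exists_eq_succ_of_ne_zero (pow_ne_zero m two_ne_zero)
        rw [hl]
        exact p.pow_le b l)
    simpa using this
  refine le_of_sq_le_sq ?_ (mul_nonneg (h0 c) (norm_nonneg _))
  refine (hsq c).trans ((mul_le_mul_of_nonneg_left h1 (norm_nonneg _)).trans_eq ?_)
  rw [hb, p.star_mul_self]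
  ring

end

/-! ### The Stinespring space and its representation -/

section

variable {A : Type u} [Ring A] [StarRing A] [Algebra ℂ A] {ι : Type u} [Preorder ι]
  [IsDirectedOrder ι] {H : LocallyHilbertSpace.{u, w} ι} {n : ℕ}
  {φ : Fin n → Fin n → A →ₗ[ℂ] Op H H}

theorem IsCompletelyPositive.exists_generates_stinespring [Nonempty ι]
    (hφ : IsCompletelyPositive (entrywiseMap φ)) :
    ∃ (X : LocallyHilbertSpace.{u, max u w} ι) (k : A × Fin n × H → X),
      Generates X (stinespringSet A n H) k ∧ ∀ g h, ⟪k g, k h⟫_ℂ = stinespringKernel φ g h := by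
  obtain ⟨E, _, _, _, k, hk⟩ := exists_inner_eq_kernel (stinespringKernel φ)
    hφ.conj_stinespringKernel hφ.stinespringKernel_nonneg
  obtain ⟨X, j, k', hj, hk'⟩ := exists_generates (s := stinespringSet A n H) k
    (fun α β h g hg => H.level_mono h hg) (fun g => H.exists_mem_level g.2.2)
    (fun α => isClosed_closure.isComplete)
  exact ⟨X, k', hk', fun g h => by rw [← hk, ← hj, ← hj, j.inner_map_map]⟩

variable {X : LocallyHilbertSpace.{u, w₁} ι} {k : A × Fin n × H → X}
  (hg : Generates X (stinespringSet A n H) k)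
  (hk : ∀ g h, ⟪k g, k h⟫_ℂ = stinespringKernel φ g h)

include hg hk

/-- Generators are determined by their inner products with all generators, so linearity of the
kernel in its second argument passes to k; the next three lemmas follow the same way. -/
theorem LocallyHilbertSpace.Generates.stinespring_add_left (a b : A) (x : Fin n × H) :
    k (a + b, x) = k (a, x) + k (b, x) := hg.eq_of_inner fun g => by
  rw [inner_add_right, hk, hk, hk, stinespringKernel, mul_add, map_add]
  exact inner_add_right _ _ _

theorem LocallyHilbertSpace.Generates.stinespring_smul_left (c : ℂ) (a : A) (x : Fin n × H) :
    k (c • a, x) = c • k (a, x) := hg.eq_of_inner fun g => by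
  rw [inner_smul_right, hk, hk, stinespringKernel, mul_smul_comm, map_smul]
  exact inner_smul_right _ _ _

theorem LocallyHilbertSpace.Generates.stinespring_add_right (a : A) (i : Fin n) (x y : H) :
    k (a, i, x + y) = k (a, i, x) + k (a, i, y) := hg.eq_of_inner fun g => by
  rw [inner_add_right, hk, hk, hk, stinespringKernel, map_add]
  exact inner_add_right _ _ _

theorem LocallyHilbertSpace.Generates.stinespring_smul_right (c : ℂ) (a : A) (i : Fin n) (x : H) :
    k (a, i, c • x) = c • k (a, i, x) := hg.eq_of_inner fun g => by
  rw [inner_smul_right, hk, hk, stinespringKernel, map_smul]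
  exact inner_smul_right _ _ _

variable [TopologicalSpace A] {p : ι → CStarSeminorm A} {C : ι → ℝ} (hC : ∀ α, 0 ≤ C α)
  (hp : ∀ α i j a, ∀ x ∈ H.level α, ‖φ i j a x‖ ≤ C α * p α a * ‖x‖)

include hC hp

/-- The operator `ξ ↦ 1 ⊗ ξ e_i`. -/
theorem LocallyHilbertSpace.Generates.exists_embedding (i : Fin n) : ∃ S : Op H X, ∀ ξ, S ξ = k (1, i, ξ) := by
  refine ⟨Op.ofDual hg
    { toFun := fun ξ => k (1, i, ξ)
      map_add' := hg.stinespring_add_right hk 1 i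
      map_smul' := fun c => hg.stinespring_smul_right hk c 1 i }
    -- The adjoint on generators is read off the kernel; it preserves levels because the adjoint of
    -- φ_ji(a*) lies in L(H).
    (fun g => (φ g.2.1 i (star g.1 * 1)).adjoint g.2.2) (fun α ξ hξ => hg.mem_level hξ)
    (fun α => ⟨√(C α) * p α 1 * p α 1, fun ξ hξ => ?_⟩) (fun α g hgα => Op.map_mem _ hgα)
    (fun g ξ => ?_), fun ξ => rfl⟩
  · have h1 := norm_leftMul_generator_le hk (hC α) (hp α) (g := (1, i, ξ)) hξ 1
    rw [one_leftMul] at h1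
    refine h1.trans_eq ?_
    ring
  · rw [Op.adjoint_inner_left]
    exact hk _ _

/-- The representation `π(a) (b ⊗ ξ e_i) = a b ⊗ ξ e_i`. -/
theorem LocallyHilbertSpace.Generates.exists_starAlgHom : ∃ π : A →⋆ₐ[ℂ] Op X X,
    (∀ a g, π a (k g) = k (leftMul a g)) ∧
    ∀ α a, ∀ x ∈ X.level α, ‖π a x‖ ≤ p α a * ‖x‖ := by
  have hex : ∀ a : A, ∃ T : Op X X, (∀ g, T (k g) = k (leftMul a g)) ∧
      (∀ g, T.adjoint (k g) = k (leftMul (star a) g)) ∧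
      ∀ α, ∀ x ∈ X.level α, ‖T x‖ ≤ p α a * ‖x‖ := fun a =>
    hg.exists_op hg (fun g => k (leftMul a g)) (fun g => k (leftMul (star a) g))
      (fun α g h => hg.mem_level h) (fun α g h => hg.mem_level h)
      (fun g g' => by rw [hk, hk, stinespringKernel_leftMul]) (fun α => p α a)
      (fun α v hv => norm_linearCombination_leftMul_le hk (hC α) (hp α) hv a)
  choose π h1 h2 h3 using hex
  have hadd : ∀ a b, π (a + b) = π a + π b := fun a b => hg.op_ext fun g => by
    change _ = π a (k g) + π b (k g)
    rw [h1, h1, h1, leftMul, add_mul]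
    exact hg.stinespring_add_left hk _ _ _
  have hsmul : ∀ (c : ℂ) a, π (c • a) = c • π a := fun c a => hg.op_ext fun g => by
    change _ = c • π a (k g)
    rw [h1, h1, leftMul, smul_mul_assoc]
    exact hg.stinespring_smul_left hk _ _ _
  have hone : π 1 = 1 := hg.op_ext fun g => by
    rw [h1, one_leftMul]
    rfl
  have hmul : ∀ a b, π (a * b) = π a * π b := fun a b => hg.op_ext fun g => by
    change _ = π a (π b (k g))
    rw [h1, h1, h1, leftMul_mul]
  let π₀ : A →ₗ[ℂ] Op X X := { toFun := π, map_add' := hadd, map_smul' := hsmul }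
  refine ⟨{ AlgHom.ofLinearMap π₀ hone hmul with
    map_star' := fun a => hg.op_ext fun g => ?_ }, h1, fun α a => h3 a α⟩
  change π (star a) (k g) = (π a).adjoint (k g)
  rw [h1, h2]

end

/-! ### Hilbert modules and column vectors -/

section

open MulOpposite

variable {A : Type u} [Ring A] [StarRing A] [Algebra ℂ A] [StarModule ℂ A]
  [UniformSpace A] [IsUniformAddGroup A] {M : Type v} [AddCommGroup M] [Module ℂ M]
  [Module Aᵐᵒᵖ M] [UniformSpace M] [IsUniformAddGroup M] [HilbertModule A M]

namespace HilbertModule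

theorem inner_op_smul_left (x y : M) (a : A) : inner A (op a • x) y = star a * inner A x y := by
  rw [← star_inner, inner_op_smul_right, star_mul, star_inner]

theorem ext_inner {x y : M} (h : ∀ z : M, inner A z x = inner A z y) : x = y := by
  have h1 : inner A (x - y) (x - y) = 0 := by
    rw [sub_eq_add_neg x, ← neg_one_smul ℂ y, inner_add_right, inner_smul_right, h, neg_one_smul,
      neg_one_smul, add_neg_cancel]
  exact sub_eq_zero.mp (eq_zero_of_inner_self _ h1)

/-- The compatibility of the two scalar actions is not an axiom here; nondegeneracy of the inner
product forces it. -/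
theorem op_smul_smul (a : A) (c : ℂ) (x : M) : op a • c • x = c • op a • x :=
  ext_inner (A := A) fun z => by
    rw [inner_op_smul_right, inner_smul_right, inner_smul_right, inner_op_smul_right,
      smul_mul_assoc]

end HilbertModule

variable {ι : Type u} [Preorder ι] [IsDirectedOrder ι] {H : LocallyHilbertSpace.{u, w} ι}
  {K : LocallyHilbertSpace.{u, w₁} ι} {n : ℕ}
  {φ : Fin n → Fin n → A →ₗ[ℂ] Op H H} {Φ : Fin n → Fin n → M →ₗ[ℂ] Op H K}

/-- The vector `(Φ_rj(x) ξ)_r` of `K^n`. -/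
def columnVector (Φ : Fin n → Fin n → M →ₗ[ℂ] Op H K) (g : M × Fin n × H) :
    PiLp 2 fun _ : Fin n => (K : Type w₁) :=
  WithLp.toLp 2 fun r => Φ r g.2.1 g.1 g.2.2

theorem inner_columnVector
    (hΦ : ∀ (x y : M) (i j : Fin n),
      ∑ r, ((Φ r i x).adjoint).comp (Φ r j y) = φ i j (inner A x y)) (g h : M × Fin n × H) :
    ⟪columnVector Φ g, columnVector Φ h⟫_ℂ = ⟪g.2.2, φ g.2.1 h.2.1 (inner A g.1 h.1) h.2.2⟫_ℂ := by
  rw [← hΦ, Op.sum_apply, inner_sum, PiLp.inner_apply]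
  exact Finset.sum_congr rfl fun r _ => (Op.inner_adjoint_right _ _ _).symm

/-- The vectors of `K^n` with coordinates in `K_α` form a complete space. -/
theorem isComplete_piLp_level (K : LocallyHilbertSpace.{u, w₁} ι) (n : ℕ) (α : ι) :
    IsComplete {z : PiLp 2 fun _ : Fin n => (K : Type w₁) | ∀ r, z r ∈ K.level α} := by
  let f : (PiLp 2 fun _ : Fin n => K.level α) →+ PiLp 2 fun _ : Fin n => (K : Type w₁) :=
    { toFun := fun z => WithLp.toLp 2 fun r => (z r : K)
      map_zero' := rfl
      map_add' := fun _ _ => rfl }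
  have hf : Isometry f := AddMonoidHomClass.isometry_of_norm f fun z => by
    rw [PiLp.norm_eq_of_L2, PiLp.norm_eq_of_L2]
    rfl
  refine (congrArg IsComplete (Set.ext fun z => ?_)).mp hf.isUniformInducing.isComplete_range
  exact ⟨fun ⟨y, hy⟩ r => hy ▸ (y r).2, fun hz => ⟨WithLp.toLp 2 fun r => ⟨z r, hz r⟩, rfl⟩⟩

theorem IsComplete.of_isClosed_subset {X : Type*} [UniformSpace X] {s t : Set X}
    (hs : IsComplete s) (ht : IsClosed t) (hts : t ⊆ s) : IsComplete t := fun f hf hft => by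
  obtain ⟨x, -, hx⟩ := hs f hf (hft.trans (Filter.principal_mono.mpr hts))
  have := hf.1
  exact ⟨x, ht.mem_of_tendsto (f := id) hx (Filter.le_principal_iff.mp hft), hx⟩

end

section

variable {M : Type v} [AddCommGroup M] [Module ℂ M] {ι : Type u} [Preorder ι]
  [IsDirectedOrder ι] {H : LocallyHilbertSpace.{u, w} ι} {K : LocallyHilbertSpace.{u, w₁} ι}
  {n : ℕ}

/-- K^n itself need not be complete, but the generators of level α have coordinates in K_α, so their
closed span sits inside a complete set. -/
theorem exists_generates_columnVector [Nonempty ι] (Φ : Fin n → Fin n → M →ₗ[ℂ] Op H K) :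
    ∃ (Y : LocallyHilbertSpace.{u, w₁} ι) (j : Y →ₗᵢ[ℂ] PiLp 2 fun _ : Fin n => (K : Type w₁))
      (k : M × Fin n × H → Y), (∀ g, j (k g) = columnVector Φ g) ∧
      Generates Y (fun α => {g | g.2.2 ∈ H.level α}) k := by
  refine exists_generates _ (fun α β h g hg => H.level_mono h hg)
    (fun g => H.exists_mem_level g.2.2) fun α => ?_
  refine (isComplete_piLp_level K n α).of_isClosed_subset isClosed_closure
    (closure_minimal (fun z hz r => ?_) (isComplete_piLp_level K n α).isClosed)
  induction hz using Submodule.span_induction with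
  | mem z hz =>
    obtain ⟨g, hg, rfl⟩ := hz
    exact Op.map_mem _ hg
  | zero => exact zero_mem _
  | add x y _ _ hx hy => exact add_mem hx hy
  | smul c x _ hx => exact Submodule.smul_mem _ c hx

end

theorem continuous_of_continuous_entrywiseMap {A B : Type*} [Ring A] [Algebra ℂ A]
    [TopologicalSpace A] [Ring B] [Algebra ℂ B] [TopologicalSpace B] {n : ℕ}
    {φ : Fin n → Fin n → A →ₗ[ℂ] B} (h : Continuous (entrywiseMap φ))
    (i j : Fin n) : Continuous (φ i j) := by
  -- The matrix with all entries equal to a serves every pair (i, j) at once.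
  have h1 : Continuous fun a : A => (Matrix.of fun _ _ => a : Matrix (Fin n) (Fin n) A) :=
    continuous_matrix fun _ _ => continuous_id
  exact (h.comp h1).matrix_elem i j

namespace LocallyHilbertSpace.Generates

variable {ι : Type u} [Preorder ι] [IsDirectedOrder ι] {H : LocallyHilbertSpace.{u, w} ι}
  {G : Type*} {s : ι → Set G} {k : G → H}

theorem level_le (hk : Generates H s k) {α : ι} {S : Submodule ℂ H} (hS : IsClosed (S : Set H))
    (h : ∀ g ∈ s α, k g ∈ S) : H.level α ≤ S := by
  rw [← SetLike.coe_subset_coe, hk.level_eq]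
  refine closure_minimal (Submodule.span_le.mpr ?_) hS
  rintro _ ⟨g, hg, rfl⟩
  exact h g hg

theorem clm_ext (hk : Generates H s k) {F : Type*} [NormedAddCommGroup F] [NormedSpace ℂ F]
    {f f' : H →L[ℂ] F} (h : ∀ g, f (k g) = f' (k g)) : f = f' := by
  ext x
  obtain ⟨α, hα⟩ := H.exists_mem_level x
  exact hk.level_le (S := LinearMap.eqLocus f.toLinearMap f'.toLinearMap)
    (isClosed_eq f.continuous f'.continuous) (fun g _ => h g) hα

end LocallyHilbertSpace.Generates

/-! ### Coordinate operators and the module map -/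

section

open MulOpposite

variable {A : Type u} [Ring A] [StarRing A] [Algebra ℂ A] [StarModule ℂ A]
  [UniformSpace A] [IsUniformAddGroup A] {M : Type v} [AddCommGroup M] [Module ℂ M]
  [Module Aᵐᵒᵖ M] [UniformSpace M] [IsUniformAddGroup M] [HilbertModule A M]
  {ι : Type u} [Preorder ι] [IsDirectedOrder ι] {H : LocallyHilbertSpace.{u, w} ι}
  {K : LocallyHilbertSpace.{u, w₁} ι} {X : LocallyHilbertSpace.{u, w₂} ι}
  {Y : LocallyHilbertSpace.{u, w₁} ι} {n : ℕ}
  {φ : Fin n → Fin n → A →ₗ[ℂ] Op H H} {Φ : Fin n → Fin n → M →ₗ[ℂ] Op H K}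
  {l : M × Fin n × H → Y}

/-- The coordinate maps are operators from the locally Hilbert space generated by the column vectors
to `K`. -/
theorem LocallyHilbertSpace.Generates.exists_coordinate
    (hl : Generates Y (fun α => {g : M × Fin n × H | g.2.2 ∈ H.level α}) l)
    (hlφ : ∀ g h, ⟪l g, l h⟫_ℂ = ⟪g.2.2, φ g.2.1 h.2.1 (inner A g.1 h.1) h.2.2⟫_ℂ)
    {j : Y →ₗᵢ[ℂ] PiLp 2 fun _ : Fin n => (K : Type w₁)}
    (hj : ∀ g, j (l g) = columnVector Φ g) (r : Fin n) :
    ∃ V : Op Y K, ∀ g, V (l g) = Φ r g.2.1 g.1 g.2.2 := by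
  let f : Y →L[ℂ] K := (PiLp.proj 2 (fun _ : Fin n => (K : Type w₁)) r).comp j.toContinuousLinearMap
  have hf : ∀ g, f (l g) = Φ r g.2.1 g.1 g.2.2 := fun g => congrArg (fun z => z r) (hj g)
  -- Since φ_ij(a) commutes with projections, projecting a column vector onto Y_α amounts to
  -- projecting ξ onto H_α. Commutation of V with the projections then reduces to that of Φ_ri(x).
  have hproj : ∀ (α : ι) (x : M) (i : Fin n) (ξ : H),
      (Y.level α).starProjection (l (x, i, ξ)) = l (x, i, (H.level α).starProjection ξ) := by
    refine fun α x i ξ => Submodule.eq_starProjection_of_mem_of_inner_eq_zero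
      (hl.mem_level (Submodule.starProjection_apply_mem _ ξ)) fun y hy => ?_
    refine inner_eq_zero_symm.mp (hl.inner_eq_zero (fun g hg => ?_) hy)
    rw [inner_sub_right, hlφ, hlφ, ← inner_sub_right, ← map_sub, ← Op.adjoint_inner_left]
    exact Submodule.inner_right_of_mem_orthogonal (Op.map_mem _ hg)
      (Submodule.sub_starProjection_mem_orthogonal ξ)
  refine ⟨⟨f.toLinearMap, fun α x hx => ?_, fun α => ⟨‖f‖, fun x _ => f.le_opNorm x⟩,
    fun α x => ?_⟩, hf⟩
  · refine hl.level_le (S := (K.level α).comap f.toLinearMap)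
      ((K.isClosed_level α).preimage f.continuous) (fun g hg => ?_) hx
    change f (l g) ∈ K.level α
    rw [hf]
    exact Op.map_mem _ hg
  · have h1 : (K.level α).starProjection.comp f = f.comp (Y.level α).starProjection := by
      refine hl.clm_ext fun g => ?_
      change (K.level α).starProjection (f (l g)) = f ((Y.level α).starProjection (l g))
      rw [hproj, hf, hf, Op.proj_apply]
    exact congrArg (fun T : Y →L[ℂ] K => T x) h1

variable {k : A × Fin n × H → X} {p : ι → CStarSeminorm A} {C : ι → ℝ}

/-- The module map `π(x) (a ⊗ ξ e_i) = (Φ_ri(x a) ξ)_r`. -/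
theorem LocallyHilbertSpace.Generates.exists_moduleMap
    (hg : Generates X (stinespringSet A n H) k)
    (hk : ∀ g h, ⟪k g, k h⟫_ℂ = stinespringKernel φ g h)
    (hC : ∀ α, 0 ≤ C α) (hp : ∀ α i j a, ∀ x ∈ H.level α, ‖φ i j a x‖ ≤ C α * p α a * ‖x‖)
    (hl : Generates Y (fun α => {g : M × Fin n × H | g.2.2 ∈ H.level α}) l)
    (hlφ : ∀ g h, ⟪l g, l h⟫_ℂ = ⟪g.2.2, φ g.2.1 h.2.1 (inner A g.1 h.1) h.2.2⟫_ℂ) :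
    ∃ P : M →ₗ[ℂ] Op X Y, (∀ x g, P x (k g) = l (op g.1 • x, g.2)) ∧
      (∀ x g, (P x).adjoint (l g) = k (inner A x g.1, g.2)) ∧
      ∀ α x, ∀ z ∈ X.level α, ‖P x z‖ ≤ √(p α (inner A x x)) * ‖z‖ := by
  have hex : ∀ x : M, ∃ T : Op X Y, (∀ g, T (k g) = l (op g.1 • x, g.2)) ∧
      (∀ g, T.adjoint (l g) = k (inner A x g.1, g.2)) ∧
      ∀ α, ∀ z ∈ X.level α, ‖T z‖ ≤ √(p α (inner A x x)) * ‖z‖ := fun x => by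
    refine hg.exists_op hl (fun g => l (op g.1 • x, g.2)) (fun g => k (inner A x g.1, g.2))
      (fun α g h => hl.mem_level h) (fun α g h => hg.mem_level h) (fun g g' => ?_)
      (fun α => √(p α (inner A x x))) (fun α v hv => ?_)
    · rw [hlφ, hk, stinespringKernel, HilbertModule.inner_op_smul_right, HilbertModule.star_inner]
    · have h0 : 0 ≤ p α (inner A x x) := apply_nonneg _ _
      refine le_of_sq_le_sq ?_ (mul_nonneg (Real.sqrt_nonneg _) (norm_nonneg _))
      -- The squared norm of the image of v is ⟨v, π(⟨x, x⟩) v⟩, to which the bound on left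
      -- multiplication by ⟨x, x⟩ applies.
      rw [← inner_self_eq_norm_sq (𝕜 := ℂ), inner_linearCombination_congr (a' := k)
        (b' := fun g => k (leftMul (inner A x x) g))]
      · refine (Complex.re_le_norm _).trans ((norm_inner_le_norm _ _).trans ?_)
        refine (mul_le_mul_of_nonneg_left
          (norm_linearCombination_leftMul_le hk (hC α) (hp α) hv _) (norm_nonneg _)).trans_eq ?_
        rw [mul_pow, Real.sq_sqrt h0]
        ring
      · intro g h
        rw [hlφ, hk, stinespringKernel, leftMul, HilbertModule.inner_op_smul_right,
          HilbertModule.inner_op_smul_left, mul_assoc]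
  choose P h1 h2 h3 using hex
  refine ⟨{ toFun := P
            map_add' := fun x y => hg.op_ext fun g => ?_
            map_smul' := fun c x => hg.op_ext fun g => ?_ }, h1, h2, fun α x => h3 x α⟩
  · change _ = P x (k g) + P y (k g)
    refine hl.eq_of_inner fun h => ?_
    rw [h1, h1, h1, inner_add_right, hlφ, hlφ, hlφ, smul_add, HilbertModule.inner_add_right,
      map_add]
    exact inner_add_right _ _ _
  · change _ = c • P x (k g)
    refine hl.eq_of_inner fun h => ?_
    rw [h1, h1, inner_smul_right, hlφ, hlφ, HilbertModule.op_smul_smul,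
      HilbertModule.inner_smul_right, map_smul]
    exact inner_smul_right _ _ _

end

/-! ### The dilation theorem -/

theorem theorem2p2 {A : Type u} [Ring A] [StarRing A] [Algebra ℂ A] [StarModule ℂ A]
    [UniformSpace A] [IsUniformAddGroup A] [LocallyCStarAlgebra A]
    {M : Type v} [AddCommGroup M] [Module ℂ M] [Module Aᵐᵒᵖ M]
    [UniformSpace M] [IsUniformAddGroup M] [HilbertModule A M]
    (H : LocallyHilbertSpace.{u, w} (CStarSeminorm A))
    (K : LocallyHilbertSpace.{u, w₁} (CStarSeminorm A)) (n : ℕ)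
    (φ : Fin n → Fin n → A →ₗ[ℂ] LocallyHilbertSpace.Op H H)
    (Φ : Fin n → Fin n → M →ₗ[ℂ] LocallyHilbertSpace.Op H K)
    (hΦ : IsCompletelyPositiveMatrix φ Φ) :
    ∃ (HΦ : LocallyHilbertSpace.{u, max u w} (CStarSeminorm A))
      (KΦ : LocallyHilbertSpace.{u, w₁} (CStarSeminorm A))
      (πφ : A →⋆ₐ[ℂ] LocallyHilbertSpace.Op HΦ HΦ)
      (πΦ : M →ₗ[ℂ] LocallyHilbertSpace.Op HΦ KΦ)
      (S : Fin n → LocallyHilbertSpace.Op H HΦ)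
      (W : Fin n → LocallyHilbertSpace.Op K KΦ),
      IsRepresentation πΦ πφ ∧
      (∀ i, @Continuous H HΦ H.topology HΦ.topology (S i)) ∧
      (∀ i, @Continuous K KΦ K.topology KΦ.topology (W i)) ∧
      (∀ (a : A) (i j : Fin n), φ i j a = (S i).adjoint.comp ((πφ a).comp (S j))) ∧
      (∀ (x : M) (i j : Fin n), Φ i j x = (W i).adjoint.comp ((πΦ x).comp (S j))) ∧
      HΦ.closedSpan {z | ∃ (a : A) (i : Fin n) (ξ : H), z = πφ a (S i ξ)} = Set.univ ∧
      KΦ.closedSpan {z | ∃ (x : M) (i : Fin n) (ξ : H), z = πΦ x (S i ξ)} = Set.univ := by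
  have hbound : ∀ α, ∃ (p : CStarSeminorm A) (C : ℝ), 0 ≤ C ∧
      ∀ i j a, ∀ x ∈ H.level α, ‖φ i j a x‖ ≤ C * p a * ‖x‖ := fun α => by
    let f : Fin n × Fin n → A →ₗ[ℂ] H.level α →L[ℂ] H.level α :=
      fun ij => Op.restrictₗ H H α ∘ₗ φ ij.1 ij.2
    have hf : ∀ ij, Continuous (f ij) := fun ij => (Op.continuous_restrict α).comp
      (continuous_of_continuous_entrywiseMap hΦ.continuous_left ij.1 ij.2)
    obtain ⟨p, C, hC, h⟩ := exists_cstarSeminorm_bound (J := Fin n × Fin n)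
      (F := H.level α →L[ℂ] H.level α) f hf
    exact ⟨p, C, hC, fun i j a x hx => (Op.norm_apply_le_restrict _ hx).trans
      (mul_le_mul_of_nonneg_right (h (i, j) a) (norm_nonneg x))⟩
  choose p C hC hp using hbound
  obtain ⟨X, k, hg, hk⟩ := hΦ.completelyPositive_left.exists_generates_stinespring
  obtain ⟨Y, j, l, hj, hl⟩ := exists_generates_columnVector Φ
  have hlφ : ∀ g h, ⟪l g, l h⟫_ℂ = ⟪g.2.2, φ g.2.1 h.2.1 (inner A g.1 h.1) h.2.2⟫_ℂ :=
    fun g h => by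
      rw [← j.inner_map_map, hj, hj, inner_columnVector hΦ.sum_adjoint_comp]
  obtain ⟨π, hπ, hπp⟩ := hg.exists_starAlgHom hk hC hp
  obtain ⟨P, hP, hPadj, hPp⟩ := hg.exists_moduleMap hk hC hp hl hlφ
  choose S hS using hg.exists_embedding hk hC hp
  choose V hV using hl.exists_coordinate hlφ hj
  have hπS : ∀ a i ξ, π a (S i ξ) = k (a, i, ξ) := fun a i ξ => by
    rw [hS, hπ, leftMul, mul_one]
  have hPS : ∀ x i ξ, P x (S i ξ) = l (x, i, ξ) := fun x i ξ => by
    rw [hS, hP, MulOpposite.op_one, one_smul]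
  -- The coordinate operators V_i go from K^Φ to K, so W_i is their adjoint and W_i* = V_i.
  refine ⟨X, Y, π, P, S, fun i => (V i).adjoint, ⟨?_, ?_, fun x y => hg.op_ext fun g => ?_⟩,
    fun i => (S i).continuous_topology, fun i => (V i).adjoint.continuous_topology,
    fun a i j => Op.ext fun ξ => ext_inner_left ℂ fun η => ?_, fun x i j => Op.ext fun ξ => ?_,
    hg.closedSpan_eq_univ fun g => ⟨g.1, g.2.1, g.2.2, (hπS _ _ _).symm⟩,
    hl.closedSpan_eq_univ fun g => ⟨g.1, g.2.1, g.2.2, (hPS _ _ _).symm⟩⟩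
  · refine Op.continuous_of_bound P fun α ε hε => ?_
    filter_upwards [(HilbertModule.hasBasis_nhds_zero (A := A) (M := M)).mem_of_mem
      (i := (p α, ε)) hε] with x hx z hz
    exact (hPp α x z hz).trans (mul_le_mul_of_nonneg_right (le_of_lt hx) (norm_nonneg z))
  · refine Op.continuous_of_bound (π : A →ₐ[ℂ] Op X X).toLinearMap fun α ε hε => ?_
    filter_upwards [(LocallyCStarAlgebra.hasBasis_nhds_zero (A := A)).mem_of_mem
      (i := (p α, ε)) hε] with a ha z hz
    exact (hπp α a z hz).trans (mul_le_mul_of_nonneg_right (le_of_lt ha) (norm_nonneg z))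
  · change (P x).adjoint (P y (k g)) = _
    rw [hP, hPadj, hπ, HilbertModule.inner_op_smul_right]
    rfl
  · change _ = ⟪η, (S i).adjoint (π a (S j ξ))⟫_ℂ
    rw [hπS, Op.inner_adjoint_right, hS, hk, stinespringKernel, star_one, one_mul]
  · change _ = (V i).adjoint.adjoint (P x (S j ξ))
    rw [Op.adjoint_adjoint, hPS, hV]

end
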